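/- Let $\boldsymbol{T} = (\mathbb{R}\cup\{-\infty\}, \max, +)$ be the tropical semifield, and let $\overline{\boldsymbol{T}(\boldsymbol{Y})} = \overline{\boldsymbol{T}(Y_1,\dots,Y_m)}$ be the tropical rational function semifield, i.e. the semifield of fractions of the semiring of tropical polynomials in $Y_1,\dots,Y_m$ modulo equality as functions on $(\mathbb{R}\cup\{-\infty\})^m$. For a congruence $C$ on $\overline{\boldsymbol{T}(\boldsymbol{Y})}$ put $\boldsymbol{V}(C) = \{x\in\mathbb{R}^m : f(x)=g(x) \text{ for all } (f,g)\in C\}$, and for $V\subset\mathbb{R}^m$ let $\boldsymbol{E}(V)$ be the congruence $\{(f,g) : f(x)=g(x) \text{ for all } x\in V\}$. A semifield over $\boldsymbol{T}$ is a semifield $S$ with an injective semiring homomorphism $\boldsymbol{T}\to S$. For semifields $S_1,S_2$ over $\boldsymbol{T}$, the pseudodirect product $S_1\bowtie S_2 = \{(s_1,s_2) : s_1\neq 0,\ s_2\neq 0\}\cup\{(0,0)\}$ carries the componentwise operations and is a $\boldsymbol{T}$-algebra via the diagonal homomorphism $t\mapsto(t,t)$. Let $T$ be a finitely generated semifield over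 $\boldsymbol{T}$, and let $\varphi\colon\overline{\boldsymbol{T}(\boldsymbol{Y})}\to T$ be a surjective $\boldsymbol{T}$-algebra homomorphism with kernel congruence $\operatorname{Ker}(\varphi)=\{(f,g):\varphi(f)=\varphi(g)\}$. Suppose that $\operatorname{Ker}(\varphi)=\boldsymbol{E}(\boldsymbol{V}(\operatorname{Ker}(\varphi)))$ and that $\boldsymbol{V}(\operatorname{Ker}(\varphi))$ is the disjoint union of two nonempty closed subsets $V_1$ and $V_2$ of $\mathbb{R}^m$. Then there is an injective $\boldsymbol{T}$-algebra homomorphism $$\gamma\colon T\to \overline{\boldsymbol{T}(\boldsymbol{Y})}/\boldsymbol{E}(V_1)\ \bowtie\ \overline{\boldsymbol{T}(\boldsymbol{Y})}/\boldsymbol{E}(V_2),\qquad \gamma(\varphi(f)) = ([f]_{\boldsymbol{E}(V_1)},[f]_{\boldsymbol{E}(V_2)})\quad\text{for all } f\in\overline{\boldsymbol{T}(\boldsymbol{Y})}.$$ If in addition $V_1$ and $V_2$ are finite unions of $\mathbb{R}$-rational polyhedral sets (sets $\{x : Ax\ge b\}$ with $A$ a rational matrix and $b$ a real vector) satisfying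 $(\ast)$ below, then $\gamma$ is an isomorphism of $\boldsymbol{T}$-algebras. $(\ast)$ For $(i,j)=(1,2),(2,1)$: if $e$ is a ray of $V_i$, i.e. a half-line $\{p+tv : t\ge 0\}$ (with $p,v\in\mathbb{R}^m$, $v\neq 0$) contained in $V_i$, then there is no $a\in\mathbb{R}^m$ such that $e+a$ is a ray of $V_j$. -/

import Mathlib

noncomputable section

namespace TropicalCongruence

/-- The tropical semifield `ℝ ∪ {-∞}`: addition is `max`, multiplication is the sum of reals.
Mathlib's `Tropical R` takes minima in `R`, so `max` is obtained from the order dual `ℝᵒᵈ`,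
whose added top element plays the role of `-∞` and is the `0` of the semiring. -/
abbrev TropReal : Type := Tropical (WithTop ℝᵒᵈ)

/-- The inclusion of the real numbers into the tropical semifield. -/
def ofReal (r : ℝ) : TropReal := Tropical.trop ((OrderDual.toDual r : ℝᵒᵈ) : WithTop ℝᵒᵈ)

theorem ofReal_ne_zero (r : ℝ) : ofReal r ≠ 0 := fun h =>
  WithTop.coe_ne_top (Tropical.trop_injective h)

theorem eq_zero_of_add_eq_zero {a b : TropReal} (h : a + b = 0) : a = 0 := by
  have h2 : a + a = a := Tropical.add_self a
  calc a = a + (a + b) := by rw [h, add_zero]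
    _ = 0 := by rw [← add_assoc, h2, h]

theorem eq_zero_of_sum_eq_zero {ι : Type*} (s : Finset ι) (f : ι → TropReal)
    (h : ∑ i ∈ s, f i = 0) : ∀ i ∈ s, f i = 0 := by
  classical
  intro i hi
  rw [← Finset.add_sum_erase s f hi] at h
  exact eq_zero_of_add_eq_zero h

theorem eq_zero_of_pow {a : TropReal} : ∀ {n : ℕ}, a ^ n = 0 → a = 0
  | 0, h => absurd h (by simp)
  | n + 1, h => by
    rw [pow_succ] at h
    exact (mul_eq_zero.1 h).elim eq_zero_of_pow id

theorem ofReal_mul (r s : ℝ) : ofReal r * ofReal s = ofReal (r + s) := rfl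

theorem exists_eq_ofReal {a : TropReal} (ha : a ≠ 0) : ∃ r, a = ofReal r := by
  obtain ⟨r, hr⟩ := WithTop.ne_top_iff_exists.1 (fun h => ha (Tropical.untrop_injective h))
  exact ⟨OrderDual.ofDual r, Tropical.untrop_injective hr.symm⟩

theorem isUnit_of_ne_zero {a : TropReal} (ha : a ≠ 0) : IsUnit a := by
  obtain ⟨r, rfl⟩ := exists_eq_ofReal ha
  refine IsUnit.of_mul_eq_one (ofReal (-r)) ?_
  rw [ofReal_mul, add_neg_cancel]
  rfl

theorem eval_ne_zero {m : ℕ} (x : Fin m → ℝ) {p : MvPolynomial (Fin m) TropReal} (hp : p ≠ 0) :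
    MvPolynomial.eval (fun i => ofReal (x i)) p ≠ 0 := by
  intro h
  obtain ⟨d, hd⟩ := MvPolynomial.ne_zero_iff.1 hp
  rw [MvPolynomial.eval_eq] at h
  have h1 := eq_zero_of_sum_eq_zero _ _ h d (MvPolynomial.mem_support_iff.2 hd)
  rcases mul_eq_zero.1 h1 with h2 | h2
  · exact hd h2
  · obtain ⟨i, -, hi⟩ := Finset.prod_eq_zero_iff.1 h2
    exact ofReal_ne_zero _ (eq_zero_of_pow hi)

/-- Two tropical polynomials are identified when they define the same function on
`(ℝ ∪ {-∞}) ^ m`. -/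
def polyFunCon (m : ℕ) : RingCon (MvPolynomial (Fin m) TropReal) where
  r p q := ∀ x : Fin m → TropReal, MvPolynomial.eval x p = MvPolynomial.eval x q
  iseqv := ⟨fun _ _ => rfl, fun h x => (h x).symm, fun h₁ h₂ x => (h₁ x).trans (h₂ x)⟩
  add' h₁ h₂ x := by rw [map_add, map_add, h₁ x, h₂ x]
  mul' h₁ h₂ x := by rw [map_mul, map_mul, h₁ x, h₂ x]

/-- The tropical polynomial function semiring in `m` variables. -/
abbrev TropPolyFun (m : ℕ) : Type := (polyFunCon m).Quotient

/-- The tropical rational function semifield in `m` variables: the semifield of fractions of the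
tropical polynomial function semiring. -/
def TropRatFun (m : ℕ) : Type := Localization (nonZeroDivisors (TropPolyFun m))

instance (m : ℕ) : CommSemiring (TropRatFun m) :=
  inferInstanceAs (CommSemiring (Localization (nonZeroDivisors (TropPolyFun m))))

instance (m : ℕ) : Algebra TropReal (TropRatFun m) :=
  inferInstanceAs (Algebra TropReal (Localization (nonZeroDivisors (TropPolyFun m))))

instance (m : ℕ) : Algebra (TropPolyFun m) (TropRatFun m) :=
  inferInstanceAs (Algebra (TropPolyFun m) (Localization (nonZeroDivisors (TropPolyFun m))))

instance (m : ℕ) : IsScalarTower TropReal (TropPolyFun m) (TropRatFun m) :=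
  inferInstanceAs (IsScalarTower TropReal (TropPolyFun m)
    (Localization (nonZeroDivisors (TropPolyFun m))))

instance (m : ℕ) : IsLocalization (nonZeroDivisors (TropPolyFun m)) (TropRatFun m) :=
  inferInstanceAs (IsLocalization (nonZeroDivisors (TropPolyFun m))
    (Localization (nonZeroDivisors (TropPolyFun m))))

/-- The value of a tropical polynomial function at a point of `(ℝ ∪ {-∞}) ^ m`. -/
def polyEval {m : ℕ} (x : Fin m → TropReal) : TropPolyFun m →ₐ[TropReal] TropReal :=
  RingCon.liftₐ (polyFunCon m) (MvPolynomial.aeval x) (fun p q h => by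
    rw [RingCon.ker_apply]
    exact h x)

theorem polyEval_mk {m : ℕ} (x : Fin m → TropReal) (p : MvPolynomial (Fin m) TropReal) :
    polyEval x ((polyFunCon m).mkₐ TropReal p) = MvPolynomial.eval x p := rfl

theorem polyEval_ne_zero {m : ℕ} (x : Fin m → ℝ) {p : TropPolyFun m} (hp : p ≠ 0) :
    polyEval (fun i => ofReal (x i)) p ≠ 0 := by
  obtain ⟨p, rfl⟩ := RingCon.mkₐ_surjective (α := TropReal) (polyFunCon m) p
  rw [polyEval_mk]
  refine eval_ne_zero x ?_
  rintro rfl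
  exact hp (map_zero _)

instance (m : ℕ) : Nontrivial (TropPolyFun m) :=
  ⟨1, 0, fun h => by
    have h' := congrArg (polyEval (fun _ => 0)) h
    rw [map_one, map_zero] at h'
    exact one_ne_zero h'⟩

instance (m : ℕ) : NoZeroDivisors (TropPolyFun m) :=
  ⟨fun {a b} h => by
    by_contra! hab
    have h' := congrArg (polyEval (fun _ => ofReal 0)) h
    rw [map_mul, map_zero] at h'
    exact (mul_eq_zero.1 h').elim (polyEval_ne_zero (fun _ => 0) hab.1)
      (polyEval_ne_zero (fun _ => 0) hab.2)⟩

theorem isUnit_polyEval {m : ℕ} (x : Fin m → ℝ) (q : nonZeroDivisors (TropPolyFun m)) :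
    IsUnit (polyEval (fun i => ofReal (x i)) (q : TropPolyFun m)) :=
  isUnit_of_ne_zero (polyEval_ne_zero x (nonZeroDivisors.coe_ne_zero q))

/-- The value `f(x) = p(x) / q(x)` of a tropical rational function `f = p / q` at a point `x` of
`ℝ ^ m`; it is `-∞` only if `f` is the constant `-∞`. -/
def ratEval {m : ℕ} (x : Fin m → ℝ) : TropRatFun m →ₐ[TropReal] TropReal :=
  IsLocalization.liftAlgHom (M := nonZeroDivisors (TropPolyFun m)) (S := TropRatFun m)
    (f := polyEval (fun i => ofReal (x i))) (isUnit_polyEval x)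

theorem ratEval_mk' {m : ℕ} (x : Fin m → ℝ) (p : TropPolyFun m)
    (q : nonZeroDivisors (TropPolyFun m)) :
    ratEval x (IsLocalization.mk' (TropRatFun m) p q) *
      polyEval (fun i => ofReal (x i)) (q : TropPolyFun m) =
        polyEval (fun i => ofReal (x i)) p := by
  have h : ∀ r : TropPolyFun m, ratEval x (algebraMap (TropPolyFun m) (TropRatFun m) r) =
      polyEval (fun i => ofReal (x i)) r := fun r =>
    IsLocalization.lift_eq (M := nonZeroDivisors (TropPolyFun m)) (S := TropRatFun m)
      (g := (polyEval (fun i => ofReal (x i))).toRingHom) (isUnit_polyEval x) r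
  rw [← h, ← h, ← map_mul, IsLocalization.mk'_spec]

theorem exists_mul_eq_one {m : ℕ} {f : TropRatFun m} (hf : f ≠ 0) : ∃ g, f * g = 1 := by
  obtain ⟨p, q, rfl⟩ := IsLocalization.exists_mk'_eq (nonZeroDivisors (TropPolyFun m)) f
  have hp : p ≠ 0 := by
    rintro rfl
    exact hf (IsLocalization.mk'_zero q)
  exact ⟨IsLocalization.mk' _ (q : TropPolyFun m) ⟨p, mem_nonZeroDivisors_of_ne_zero hp⟩,
    IsLocalization.mk'_mul_mk'_eq_one ⟨p, mem_nonZeroDivisors_of_ne_zero hp⟩ q⟩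

/-- The congruence variety in `ℝ ^ m` of a congruence on the tropical rational function
semifield. -/
def variety {m : ℕ} (C : RingCon (TropRatFun m)) : Set (Fin m → ℝ) :=
  {x | ∀ f g : TropRatFun m, C f g → ratEval x f = ratEval x g}

/-- The congruence `E(V)` of all pairs of tropical rational functions that agree on `V`. -/
def vanishingCon {m : ℕ} (V : Set (Fin m → ℝ)) : RingCon (TropRatFun m) where
  r f g := ∀ x ∈ V, ratEval x f = ratEval x g
  iseqv := ⟨fun _ _ _ => rfl, fun h x hx => (h x hx).symm,
    fun h₁ h₂ x hx => (h₁ x hx).trans (h₂ x hx)⟩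
  add' h₁ h₂ x hx := by rw [map_add, map_add, h₁ x hx, h₂ x hx]
  mul' h₁ h₂ x hx := by rw [map_mul, map_mul, h₁ x hx, h₂ x hx]

/-- The quotient of the tropical rational function semifield by `E(V)`. -/
abbrev FunOn {m : ℕ} (V : Set (Fin m → ℝ)) : Type := (vanishingCon V).Quotient

/-- The natural surjection onto the quotient by `E(V)`. -/
abbrev toFunOn {m : ℕ} (V : Set (Fin m → ℝ)) : TropRatFun m →ₐ[TropReal] FunOn V :=
  (vanishingCon V).mkₐ TropReal

instance {m : ℕ} (V : Set (Fin m → ℝ)) [hV : Nonempty V] : Nontrivial (FunOn V) :=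
  ⟨1, 0, fun h => by
    obtain ⟨x, hx⟩ := hV
    have h' : vanishingCon V 1 0 := (RingCon.eq _).1 h
    have h₂ := h' x hx
    rw [map_one, map_zero] at h₂
    exact one_ne_zero h₂⟩

theorem FunOn.exists_mul_eq_one {m : ℕ} {V : Set (Fin m → ℝ)} {a : FunOn V} (ha : a ≠ 0) :
    ∃ b, a * b = 1 := by
  obtain ⟨f, rfl⟩ := RingCon.mkₐ_surjective (α := TropReal) (vanishingCon V) a
  have hf : f ≠ 0 := by
    rintro rfl
    exact ha (map_zero _)
  obtain ⟨g, hg⟩ := TropicalCongruence.exists_mul_eq_one hf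
  exact ⟨toFunOn V g, by rw [← map_mul, hg, map_one]⟩

open Classical in
/-- For nonempty `V` the quotient by `E(V)` is a semifield. -/
instance {m : ℕ} (V : Set (Fin m → ℝ)) [Nonempty V] : Semifield (FunOn V) where
  toCommSemiring := inferInstance
  inv a := if h : a = 0 then 0 else (FunOn.exists_mul_eq_one h).choose
  mul_inv_cancel a h := by
    rw [dif_neg h]
    exact (FunOn.exists_mul_eq_one h).choose_spec
  inv_zero := dif_pos rfl
  nnqsmul := _
  nnqsmul_def := fun _ _ => rfl

/-- For nonempty `V` the structure map from the tropical numbers to the quotient by `E(V)` is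
injective, so that the quotient is a semifield over the tropical semifield. -/
theorem algebraMap_funOn_injective {m : ℕ} (V : Set (Fin m → ℝ)) [hV : Nonempty V] :
    Function.Injective (algebraMap TropReal (FunOn V)) := by
  intro s t h
  obtain ⟨x, hx⟩ := hV
  rw [← (toFunOn V).commutes, ← (toFunOn V).commutes] at h
  have h' : vanishingCon V (algebraMap _ _ s) (algebraMap _ _ t) := (RingCon.eq _).1 h
  have h₂ := h' x hx
  rwa [(ratEval x).commutes, (ratEval x).commutes] at h₂

theorem left_eq_zero_of_add_eq_zero {S : Type*} [Semifield S] [Algebra TropReal S] {a b : S}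
    (h : a + b = 0) : a = 0 := by
  have h1 : (1 : S) + 1 = 1 := by
    rw [← map_one (algebraMap TropReal S), ← map_add, Tropical.add_self]
  have h2 : a + a = a := by
    calc a + a = a * (1 + 1) := by rw [mul_add, mul_one]
      _ = a := by rw [h1, mul_one]
  calc a = a + (a + b) := by rw [h, add_zero]
    _ = 0 := by rw [← add_assoc, h2, h]

theorem add_eq_zero_iff_both {S : Type*} [Semifield S] [Algebra TropReal S] {a b : S} :
    a + b = 0 ↔ a = 0 ∧ b = 0 :=
  ⟨fun h => ⟨left_eq_zero_of_add_eq_zero h, left_eq_zero_of_add_eq_zero ((add_comm b a).trans h)⟩,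
    fun h => by rw [h.1, h.2, add_zero]⟩

/-- The pseudodirect product of two semifields over the tropical semifield: the pairs whose
entries are both nonzero, together with `(0, 0)`, with componentwise operations and with the
diagonal structure map. -/
def pseudoProd (S₁ S₂ : Type*) [Semifield S₁] [Semifield S₂]
    [Algebra TropReal S₁] [Algebra TropReal S₂] : Subalgebra TropReal (S₁ × S₂) where
  carrier := {s | (s.1 ≠ 0 ∧ s.2 ≠ 0) ∨ s = (0, 0)}
  mul_mem' := by
    rintro ⟨a₁, a₂⟩ ⟨b₁, b₂⟩ (⟨h₁, h₂⟩ | h) (⟨k₁, k₂⟩ | k)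
    · exact Or.inl ⟨mul_ne_zero h₁ k₁, mul_ne_zero h₂ k₂⟩
    · exact Or.inr (by rw [k, Prod.mk_mul_mk, mul_zero, mul_zero])
    · exact Or.inr (by rw [h, Prod.mk_mul_mk, zero_mul, zero_mul])
    · exact Or.inr (by rw [h, Prod.mk_mul_mk, zero_mul, zero_mul])
  add_mem' := by
    rintro ⟨a₁, a₂⟩ ⟨b₁, b₂⟩ (⟨h₁, h₂⟩ | h) hb
    · exact Or.inl ⟨fun h => h₁ (add_eq_zero_iff_both.1 h).1,
        fun h => h₂ (add_eq_zero_iff_both.1 h).1⟩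
    · rw [h, Prod.mk_add_mk, zero_add, zero_add]
      exact hb
  algebraMap_mem' t := by
    by_cases ht : t = 0
    · exact Or.inr (by rw [ht, map_zero]; rfl)
    · exact Or.inl ⟨((isUnit_of_ne_zero ht).map (algebraMap TropReal S₁)).ne_zero,
        ((isUnit_of_ne_zero ht).map (algebraMap TropReal S₂)).ne_zero⟩

/-- An `ℝ`-rational polyhedral set: the solution set of finitely many linear inequalities
`A x ≥ b` with rational coefficients and arbitrary real right-hand sides. -/
def IsRationalPolyhedralSet {m : ℕ} (P : Set (Fin m → ℝ)) : Prop :=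
  ∃ (l : ℕ) (A : Matrix (Fin l) (Fin m) ℚ) (b : Fin l → ℝ),
    P = {x | ∀ i, b i ≤ ∑ j, (A i j : ℝ) * x j}

/-- A finite union of `ℝ`-rational polyhedral sets. -/
def IsFiniteUnionOfRationalPolyhedralSets {m : ℕ} (V : Set (Fin m → ℝ)) : Prop :=
  ∃ F : Set (Set (Fin m → ℝ)), F.Finite ∧ (∀ P ∈ F, IsRationalPolyhedralSet P) ∧ V = ⋃₀ F

/-- `e` is a ray of `V`: a half-line contained in `V`. -/
def IsRayOf {m : ℕ} (e V : Set (Fin m → ℝ)) : Prop :=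
  (∃ p v : Fin m → ℝ, v ≠ 0 ∧ e = {x | ∃ t : ℝ, 0 ≤ t ∧ x = p + t • v}) ∧ e ⊆ V

/-- No ray of `V` has a translate that is a ray of `W`. -/
def NoTranslatedRays {m : ℕ} (V W : Set (Fin m → ℝ)) : Prop :=
  ∀ e, IsRayOf e V → ¬ ∃ a : Fin m → ℝ, IsRayOf {y | ∃ x ∈ e, y = x + a} W

end TropicalCongruence

end

namespace TropicalCongruence

/-! The kernel of `φ` is `E(V₁ ∪ V₂)`, which is also the kernel of the map to pairs of classes, so
`γ` exists and is injective. Surjectivity is a gluing problem: given real functions `k₁`, `k₂` of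
nonzero rational functions, find one that equals `k₁` on `V₁` and `k₂` on `V₂`. Such functions form
a lattice-ordered group, so with `g = k₁ - k₂` it suffices to have `s` in it with `|g| ≤ s` on `V₁`
and `s ≤ 0` on `V₂`: clamp `g` to `[-s⁺, s⁺]` and add `k₂` (`DominatesAway.exists_extension`). For
two polyhedra `P`, `Q`, a large multiple of the violation of the inequalities of `Q` serves as `s`.
It vanishes on `Q`, and by compactness it grows at least linearly on `P` when there is no common
recession direction (`exists_le_violation`), whereas `g` grows at most linearly
(`linear_growth_of_mem_ratFunctions`). Maxima and minima extend this to finite unions. -/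

/-! ### The lattice-ordered group of functions given by nonzero rational functions. -/

theorem ofReal_injective : Function.Injective ofReal := fun _ _ h =>
  OrderDual.toDual.injective (WithTop.coe_injective (Tropical.trop_injective h))

theorem ofReal_add (r s : ℝ) : ofReal r + ofReal s = ofReal (max r s) := rfl

theorem ofReal_zero : ofReal 0 = 1 := rfl

theorem ratEval_ne_zero {m : ℕ} (x : Fin m → ℝ) {f : TropRatFun m} (hf : f ≠ 0) :
    ratEval x f ≠ 0 := by
  obtain ⟨g, hg⟩ := exists_mul_eq_one hf
  intro h
  have := congrArg (ratEval x) hg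
  rw [map_mul, h, zero_mul, map_one] at this
  exact zero_ne_one this

theorem ne_zero_of_ratEval {m : ℕ} {h : (Fin m → ℝ) → ℝ} {f : TropRatFun m}
    (hf : ∀ x, ratEval x f = ofReal (h x)) : f ≠ 0 := by
  rintro rfl
  exact ofReal_ne_zero _ ((hf 0).symm.trans (map_zero _))

/-- The real functions on `ℝ ^ m` defined by nonzero tropical rational functions. -/
def ratFunctions (m : ℕ) : AddSubgroup ((Fin m → ℝ) → ℝ) where
  carrier := {h | ∃ f : TropRatFun m, ∀ x, ratEval x f = ofReal (h x)}
  zero_mem' := ⟨1, fun x => map_one _⟩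
  add_mem' := by
    rintro h k ⟨f, hf⟩ ⟨g, hg⟩
    exact ⟨f * g, fun x => by rw [map_mul, hf, hg, ofReal_mul]; rfl⟩
  neg_mem' := by
    rintro h ⟨f, hf⟩
    obtain ⟨g, hg⟩ := exists_mul_eq_one (ne_zero_of_ratEval hf)
    refine ⟨g, fun x => ?_⟩
    have hx := congrArg (ratEval x) hg
    rw [map_mul, hf, map_one] at hx
    calc ratEval x g = ofReal (-h x) * (ofReal (h x) * ratEval x g) := by
          rw [← mul_assoc, ofReal_mul, neg_add_cancel, ofReal_zero, one_mul]
      _ = ofReal ((-h) x) := by rw [hx, mul_one]; rfl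

theorem sup_mem_ratFunctions {m : ℕ} {h k : (Fin m → ℝ) → ℝ} (hh : h ∈ ratFunctions m)
    (hk : k ∈ ratFunctions m) : h ⊔ k ∈ ratFunctions m := by
  obtain ⟨f, hf⟩ := hh
  obtain ⟨g, hg⟩ := hk
  exact ⟨f + g, fun x => by rw [map_add, hf, hg, ofReal_add]; rfl⟩

/-- Tropical inversion is negation, which turns maxima into minima. -/
theorem inf_mem_ratFunctions {m : ℕ} {h k : (Fin m → ℝ) → ℝ} (hh : h ∈ ratFunctions m)
    (hk : k ∈ ratFunctions m) : h ⊓ k ∈ ratFunctions m := by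
  rw [← neg_neg (h ⊓ k), neg_inf]
  exact neg_mem (sup_mem_ratFunctions (neg_mem hh) (neg_mem hk))

theorem const_mem_ratFunctions {m : ℕ} (r : ℝ) : (fun _ => r) ∈ ratFunctions m :=
  ⟨algebraMap TropReal _ (ofReal r), fun x => (ratEval x).commutes _⟩

theorem ratEval_algebraMap {m : ℕ} (x : Fin m → ℝ) (p : TropPolyFun m) :
    ratEval x (algebraMap (TropPolyFun m) (TropRatFun m) p) =
      polyEval (fun i => ofReal (x i)) p :=
  IsLocalization.lift_eq (M := nonZeroDivisors (TropPolyFun m)) (S := TropRatFun m)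
    (g := (polyEval (fun i => ofReal (x i))).toRingHom) (isUnit_polyEval x) p

theorem coord_mem_ratFunctions {m : ℕ} (i : Fin m) :
    (fun x : Fin m → ℝ => x i) ∈ ratFunctions m :=
  ⟨algebraMap (TropPolyFun m) _ ((polyFunCon m).mkₐ TropReal (MvPolynomial.X i)), fun x => by
    rw [ratEval_algebraMap, polyEval_mk, MvPolynomial.eval_X]⟩

theorem exists_ratFunction {m : ℕ} {f : TropRatFun m} (hf : f ≠ 0) :
    ∃ h ∈ ratFunctions m, ∀ x, ratEval x f = ofReal (h x) := by
  choose h hh using fun x => exists_eq_ofReal (ratEval_ne_zero x hf)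
  exact ⟨h, ⟨f, hh⟩, hh⟩

/-! ### Upper bound: rational functions grow at most linearly. -/

/-- A tropical sum is a maximum, and a factor `X i` adds a coordinate, at most the sup norm in
absolute value. The zero polynomial is set apart because its value is `-∞`. -/
theorem eval_eq_zero_or_linear_growth {m : ℕ} (p : MvPolynomial (Fin m) TropReal) :
    p = 0 ∨ ∃ L : ℝ, ∀ x : Fin m → ℝ, ∃ r : ℝ,
      MvPolynomial.eval (fun i => ofReal (x i)) p = ofReal r ∧ |r| ≤ L * (1 + ‖x‖) := by
  induction p using MvPolynomial.induction_on with
  | C a =>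
    by_cases ha : a = 0
    · exact Or.inl (by rw [ha, map_zero])
    · obtain ⟨r, rfl⟩ := exists_eq_ofReal ha
      refine Or.inr ⟨|r|, fun x => ⟨r, MvPolynomial.eval_C _, ?_⟩⟩
      exact le_mul_of_one_le_right (abs_nonneg r) (le_add_of_nonneg_right (norm_nonneg x))
  | add p q hp hq =>
    rcases hp with rfl | ⟨L, hL⟩
    · rwa [zero_add]
    rcases hq with rfl | ⟨M, hM⟩
    · rw [add_zero]
      exact Or.inr ⟨L, hL⟩
    refine Or.inr ⟨max L M, fun x => ?_⟩
    obtain ⟨r, hr, hr'⟩ := hL x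
    obtain ⟨s, hs, hs'⟩ := hM x
    refine ⟨max r s, by rw [map_add, hr, hs, ofReal_add], ?_⟩
    have h0 : 0 ≤ 1 + ‖x‖ := by positivity
    exact abs_max_le_max_abs_abs.trans (max_le
      (hr'.trans (mul_le_mul_of_nonneg_right (le_max_left _ _) h0))
      (hs'.trans (mul_le_mul_of_nonneg_right (le_max_right _ _) h0)))
  | mul_X p i hp =>
    rcases hp with rfl | ⟨L, hL⟩
    · exact Or.inl (zero_mul _)
    refine Or.inr ⟨L + 1, fun x => ?_⟩
    obtain ⟨r, hr, hr'⟩ := hL x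
    refine ⟨r + x i, by rw [map_mul, hr, MvPolynomial.eval_X, ofReal_mul], ?_⟩
    have h1 : |x i| ≤ ‖x‖ := norm_le_pi_norm x i
    have h2 := abs_add_le r (x i)
    linarith

theorem polyEval_linear_growth {m : ℕ} {p : TropPolyFun m} (hp : p ≠ 0) :
    ∃ L : ℝ, ∀ x : Fin m → ℝ, ∃ r : ℝ,
      polyEval (fun i => ofReal (x i)) p = ofReal r ∧ |r| ≤ L * (1 + ‖x‖) := by
  obtain ⟨p, rfl⟩ := RingCon.mkₐ_surjective (α := TropReal) (polyFunCon m) p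
  rcases eval_eq_zero_or_linear_growth p with rfl | h
  · exact absurd (map_zero _) hp
  · exact h

theorem linear_growth_of_mem_ratFunctions {m : ℕ} {h : (Fin m → ℝ) → ℝ}
    (hh : h ∈ ratFunctions m) : ∃ L : ℝ, ∀ x, |h x| ≤ L * (1 + ‖x‖) := by
  obtain ⟨f, hf⟩ := hh
  have hf0 := ne_zero_of_ratEval hf
  obtain ⟨p, q, rfl⟩ := IsLocalization.exists_mk'_eq (nonZeroDivisors (TropPolyFun m)) f
  have hp : p ≠ 0 := by
    rintro rfl
    exact hf0 (IsLocalization.mk'_zero q)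
  obtain ⟨L, hL⟩ := polyEval_linear_growth hp
  obtain ⟨M, hM⟩ := polyEval_linear_growth (nonZeroDivisors.coe_ne_zero q)
  refine ⟨L + M, fun x => ?_⟩
  obtain ⟨r, hr, hr'⟩ := hL x
  obtain ⟨s, hs, hs'⟩ := hM x
  have e := ratEval_mk' x p q
  rw [hf, hr, hs, ofReal_mul] at e
  have e' : h x = r - s := eq_sub_of_add_eq (ofReal_injective e)
  rw [e']
  have := abs_sub r s
  linarith

/-! ### Violation functions of rational polyhedra. -/

/-- The functions having a positive integer multiple defined by a tropical rational function. -/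
def HasRatMultiple {m : ℕ} (h : (Fin m → ℝ) → ℝ) : Prop :=
  ∃ n : ℕ, 0 < n ∧ n • h ∈ ratFunctions m

theorem HasRatMultiple.add {m : ℕ} {h k : (Fin m → ℝ) → ℝ} (hh : HasRatMultiple h)
    (hk : HasRatMultiple k) : HasRatMultiple (h + k) := by
  obtain ⟨a, ha, hh⟩ := hh
  obtain ⟨b, hb, hk⟩ := hk
  refine ⟨a * b, Nat.mul_pos ha hb, ?_⟩
  rw [smul_add, mul_smul a b k, mul_comm, mul_smul]
  exact add_mem (nsmul_mem hh b) (nsmul_mem hk a)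

theorem HasRatMultiple.of_mem {m : ℕ} {h : (Fin m → ℝ) → ℝ} (hh : h ∈ ratFunctions m) :
    HasRatMultiple h :=
  ⟨1, one_pos, by rwa [one_smul]⟩

theorem HasRatMultiple.neg {m : ℕ} {h : (Fin m → ℝ) → ℝ} (hh : HasRatMultiple h) :
    HasRatMultiple (-h) := by
  obtain ⟨n, hn, hh⟩ := hh
  exact ⟨n, hn, by rw [smul_neg]; exact neg_mem hh⟩

theorem HasRatMultiple.sup_zero {m : ℕ} {h : (Fin m → ℝ) → ℝ} (hh : HasRatMultiple h) :
    HasRatMultiple (h ⊔ 0) := by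
  obtain ⟨n, hn, hh⟩ := hh
  refine ⟨n, hn, ?_⟩
  convert sup_mem_ratFunctions hh (zero_mem _) using 1
  ext x
  change n • max (h x) 0 = max (n • h x) 0
  rw [nsmul_eq_mul, nsmul_eq_mul, mul_max_of_nonneg _ _ n.cast_nonneg, mul_zero]

theorem HasRatMultiple.sum {m : ℕ} {ι : Type*} (s : Finset ι) {h : ι → (Fin m → ℝ) → ℝ}
    (hh : ∀ i ∈ s, HasRatMultiple (h i)) : HasRatMultiple (∑ i ∈ s, h i) :=
  Finset.sum_induction h HasRatMultiple (fun _ _ => HasRatMultiple.add)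
    (HasRatMultiple.of_mem (zero_mem _)) hh

theorem hasRatMultiple_coord {m : ℕ} (q : ℚ) (i : Fin m) :
    HasRatMultiple fun x : Fin m → ℝ => (q : ℝ) * x i := by
  refine ⟨q.den, q.den_pos, ?_⟩
  convert zsmul_mem (coord_mem_ratFunctions i) q.num using 1
  ext x
  have hq : (q.den : ℝ) * q = q.num := by exact_mod_cast Rat.den_mul_eq_num q
  simp only [Pi.smul_apply, nsmul_eq_mul, zsmul_eq_mul]
  rw [← mul_assoc, hq]

/-- The total violation at `x` of the inequalities `A x ≥ b`. -/
def violation {m l : ℕ} (A : Matrix (Fin l) (Fin m) ℚ) (b : Fin l → ℝ) (x : Fin m → ℝ) : ℝ :=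
  ∑ i, max (b i - ∑ j, (A i j : ℝ) * x j) 0

/-- Rationality of `A` enters here: a multiple clears the denominators of the slopes. The constants
`b` may be any reals. -/
theorem hasRatMultiple_violation {m l : ℕ} (A : Matrix (Fin l) (Fin m) ℚ) (b : Fin l → ℝ) :
    HasRatMultiple (violation A b) := by
  have h : violation A b =
      ∑ i, (((fun _ => b i) + -∑ j, fun x : Fin m → ℝ => (A i j : ℝ) * x j) ⊔ 0) := by
    ext x
    simp [violation, sub_eq_add_neg]
  rw [h]
  exact HasRatMultiple.sum _ fun i _ =>
    ((HasRatMultiple.of_mem (const_mem_ratFunctions (b i))).add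
      (HasRatMultiple.sum _ fun j _ => hasRatMultiple_coord (A i j) j).neg).sup_zero

theorem violation_nonneg {m l : ℕ} (A : Matrix (Fin l) (Fin m) ℚ) (b : Fin l → ℝ)
    (x : Fin m → ℝ) : 0 ≤ violation A b x :=
  Finset.sum_nonneg fun _ _ => le_max_right _ _

theorem violation_eq_zero_iff {m l : ℕ} (A : Matrix (Fin l) (Fin m) ℚ) (b : Fin l → ℝ)
    (x : Fin m → ℝ) : violation A b x = 0 ↔ ∀ i, b i ≤ ∑ j, (A i j : ℝ) * x j := by
  rw [violation, Finset.sum_eq_zero_iff_of_nonneg fun _ _ => le_max_right _ _]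
  simp

/-- Joint homogeneity in the point and the right-hand side allows an unbounded polyhedron to be
rescaled into a compact set. -/
theorem violation_smul {m l : ℕ} (A : Matrix (Fin l) (Fin m) ℚ) (b : Fin l → ℝ)
    {c : ℝ} (hc : 0 ≤ c) (x : Fin m → ℝ) :
    violation A (c • b) (c • x) = c * violation A b x := by
  simp only [violation, Finset.mul_sum, Pi.smul_apply, smul_eq_mul]
  refine Finset.sum_congr rfl fun i _ => ?_
  rw [mul_max_of_nonneg _ _ hc, mul_zero, mul_sub, Finset.mul_sum]
  simp only [mul_left_comm]

theorem continuous_violation {m l : ℕ} (A : Matrix (Fin l) (Fin m) ℚ) (b : Fin l → ℝ) :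
    Continuous fun y : (Fin m → ℝ) × ℝ => violation A (y.2 • b) y.1 := by
  simp only [violation, Pi.smul_apply, smul_eq_mul]
  fun_prop

/-! ### Lower bound: linear growth of the violation away from a polyhedron. -/

/-- If two disjoint polyhedral sets have no common direction of recession, the violation of the
inequalities of one grows at least linearly on the other. -/
theorem exists_le_violation {m k l : ℕ} (A : Matrix (Fin k) (Fin m) ℚ) (b : Fin k → ℝ)
    (B : Matrix (Fin l) (Fin m) ℚ) (c : Fin l → ℝ)
    (hdisj : ∀ x, violation A b x = 0 → violation B c x ≠ 0)
    (hrec : ∀ v, violation A 0 v = 0 → violation B 0 v = 0 → v = 0) :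
    ∃ ε > 0, ∀ x, violation A b x = 0 → ε * (1 + ‖x‖) ≤ violation B c x := by
  -- A compact slice of the homogenized polyhedron: `(x, t)` with `t > 0` represents its point `x /
  -- t`, and `t = 0` gives the recession directions.
  set K : Set ((Fin m → ℝ) × ℝ) :=
    {y | 0 ≤ y.2 ∧ ‖y.1‖ + y.2 = 1 ∧ violation A (y.2 • b) y.1 = 0} with hK
  have hKc : IsCompact K := by
    refine Metric.isCompact_of_isClosed_isBounded ?_ ?_
    · exact (isClosed_le continuous_const continuous_snd).inter
        ((isClosed_eq (by fun_prop) continuous_const).inter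
          (isClosed_eq (continuous_violation A b) continuous_const))
    · refine (Metric.isBounded_closedBall (x := 0) (r := 1)).subset fun y hy => ?_
      have h1 := norm_nonneg y.1
      rw [mem_closedBall_zero_iff, Prod.norm_def, Real.norm_of_nonneg hy.1]
      exact max_le (by linarith [hy.1, hy.2.1]) (by linarith [hy.2.1])
  have hmem : ∀ x, violation A b x = 0 →
      ((1 + ‖x‖)⁻¹ • x, (1 + ‖x‖)⁻¹) ∈ K := by
    intro x hx
    have h0 : 0 < 1 + ‖x‖ := by positivity
    refine ⟨by positivity, ?_, ?_⟩
    · rw [norm_smul, Real.norm_of_nonneg (by positivity)]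
      field_simp
      ring
    · rw [violation_smul A b (by positivity), hx, mul_zero]
  have hpos : ∀ y ∈ K, 0 < violation B (y.2 • c) y.1 := by
    rintro ⟨x, t⟩ ⟨ht, hn, hA⟩
    refine lt_of_le_of_ne (violation_nonneg _ _ _) fun hB => ?_
    dsimp only at ht hn hA hB
    -- A zero of the second violation on `K` is a common recession direction of norm one if `t = 0`,
    -- and otherwise gives the common point `x / t`.
    rcases ht.eq_or_lt with rfl | ht
    · rw [zero_smul] at hA hB
      rw [hrec x hA hB.symm, norm_zero, add_zero] at hn
      exact zero_ne_one hn
    · have hs : ∀ {n : ℕ} (D : Matrix (Fin n) (Fin m) ℚ) (d : Fin n → ℝ),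
          violation D (t • d) x = 0 → violation D d (t⁻¹ • x) = 0 := by
        intro n D d hD
        have := violation_smul D (t • d) (inv_nonneg.2 ht.le) x
        rwa [inv_smul_smul₀ ht.ne', hD, mul_zero] at this
      exact hdisj _ (hs A b hA) (hs B c hB.symm)
  obtain ⟨ε, hε, hle⟩ : ∃ ε > 0, ∀ y ∈ K, ε ≤ violation B (y.2 • c) y.1 := by
    rcases K.eq_empty_or_nonempty with hE | hE
    · exact ⟨1, one_pos, by simp [hE]⟩
    · obtain ⟨y, hy, hmin⟩ := hKc.exists_isMinOn hE (continuous_violation B c).continuousOn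
      exact ⟨_, hpos y hy, fun z hz => hmin hz⟩
  refine ⟨ε, hε, fun x hx => ?_⟩
  have h0 : 0 < 1 + ‖x‖ := by positivity
  -- The bound at the normalized point is scaled back by `1 + ‖x‖`.
  have h := hle _ (hmem x hx)
  rw [violation_smul B c (by positivity), ← div_eq_inv_mul, le_div_iff₀ h0] at h
  exact h

/-! ### Domination on one set by functions nonpositive on the other. -/

/-- Every function defined by a tropical rational function is dominated on `V` by one which is
nonpositive on `W`. -/
def DominatesAway {m : ℕ} (V W : Set (Fin m → ℝ)) : Prop :=
  ∀ g ∈ ratFunctions m, ∃ s ∈ ratFunctions m, (∀ x ∈ V, g x ≤ s x) ∧ ∀ x ∈ W, s x ≤ 0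

theorem NoTranslatedRays.eq_zero {m : ℕ} {V W : Set (Fin m → ℝ)} (h : NoTranslatedRays V W)
    {p q v : Fin m → ℝ} (hp : ∀ t : ℝ, 0 ≤ t → p + t • v ∈ V)
    (hq : ∀ t : ℝ, 0 ≤ t → q + t • v ∈ W) : v = 0 := by
  by_contra hv
  refine h {x | ∃ t : ℝ, 0 ≤ t ∧ x = p + t • v} ⟨⟨p, v, hv, rfl⟩, ?_⟩ ⟨q - p, ⟨q, v, hv, ?_⟩, ?_⟩
  · rintro _ ⟨t, ht, rfl⟩
    exact hp t ht
  · ext y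
    constructor
    · rintro ⟨_, ⟨t, ht, rfl⟩, rfl⟩
      exact ⟨t, ht, by abel⟩
    · rintro ⟨t, ht, rfl⟩
      exact ⟨_, ⟨t, ht, rfl⟩, by abel⟩
  · rintro _ ⟨_, ⟨t, ht, rfl⟩, rfl⟩
    convert hq t ht using 1
    abel

/-- `violation A 0 v = 0` means `A v ≥ 0`, so `v` is a recession direction. -/
theorem add_smul_mem_polyhedral {m l : ℕ} {A : Matrix (Fin l) (Fin m) ℚ} {b : Fin l → ℝ}
    {p v : Fin m → ℝ} (hp : ∀ i, b i ≤ ∑ j, (A i j : ℝ) * p j) (hv : violation A 0 v = 0)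
    {t : ℝ} (ht : 0 ≤ t) (i : Fin l) : b i ≤ ∑ j, (A i j : ℝ) * (p + t • v) j := by
  have hi : 0 ≤ ∑ j, (A i j : ℝ) * v j := (violation_eq_zero_iff A 0 v).1 hv i
  have e : ∑ j, (A i j : ℝ) * (p + t • v) j =
      ∑ j, (A i j : ℝ) * p j + t * ∑ j, (A i j : ℝ) * v j := by
    rw [Finset.mul_sum, ← Finset.sum_add_distrib]
    refine Finset.sum_congr rfl fun j _ => ?_
    simp only [Pi.add_apply, Pi.smul_apply, smul_eq_mul]
    ring
  rw [e]
  exact (hp i).trans (le_add_of_nonneg_right (mul_nonneg ht hi))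

theorem dominatesAway_polyhedral {m : ℕ} {P Q : Set (Fin m → ℝ)}
    (hP : IsRationalPolyhedralSet P) (hQ : IsRationalPolyhedralSet Q) (hdisj : Disjoint P Q)
    (hray : NoTranslatedRays P Q) : DominatesAway P Q := by
  intro g hg
  -- Base points in both sets are needed to turn a common recession direction into parallel rays.
  rcases P.eq_empty_or_nonempty with rfl | ⟨p, hp⟩
  · exact ⟨0, zero_mem _, by simp, fun _ _ => le_rfl⟩
  rcases Q.eq_empty_or_nonempty with rfl | ⟨q, hq⟩
  · exact ⟨g, hg, fun _ _ => le_rfl, by simp⟩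
  obtain ⟨k, A, b, rfl⟩ := hP
  obtain ⟨l, B, c, rfl⟩ := hQ
  obtain ⟨ε, hε, hle⟩ := exists_le_violation A b B c
    (fun x hA hB => Set.disjoint_left.1 hdisj ((violation_eq_zero_iff A b x).1 hA)
      ((violation_eq_zero_iff B c x).1 hB))
    (fun v hA hB => hray.eq_zero (fun t ht => add_smul_mem_polyhedral hp hA ht)
      (fun t ht => add_smul_mem_polyhedral hq hB ht))
  obtain ⟨L, hL⟩ := linear_growth_of_mem_ratFunctions hg
  obtain ⟨n, hn, hmem⟩ := hasRatMultiple_violation B c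
  -- `N` makes the lower growth rate `ε` exceed the rate `L` of `g`; the factor `n ≥ 1` only clears
  -- denominators.
  obtain ⟨N, hN⟩ := exists_nat_ge (L / ε)
  refine ⟨N • n • violation B c, nsmul_mem hmem N, fun x hx => ?_, fun x hx => ?_⟩
  · have h0 := violation_nonneg B c x
    have h1 := hle x ((violation_eq_zero_iff A b x).2 hx)
    have hn' : (1 : ℝ) ≤ n := by exact_mod_cast hn
    simp only [Pi.smul_apply, nsmul_eq_mul]
    calc g x ≤ L * (1 + ‖x‖) := (le_abs_self _).trans (hL x)
      _ ≤ (N * ε) * (1 + ‖x‖) :=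
        mul_le_mul_of_nonneg_right ((div_le_iff₀ hε).1 hN) (by positivity)
      _ = N * (ε * (1 + ‖x‖)) := mul_assoc _ _ _
      _ ≤ N * (n * violation B c x) :=
        mul_le_mul_of_nonneg_left (h1.trans (le_mul_of_one_le_left h0 hn')) N.cast_nonneg
  · simp [(violation_eq_zero_iff B c x).2 hx]

/-- A minimum still dominates on `V`, and is nonpositive wherever one of its terms is. -/
theorem DominatesAway.sUnion_right {m : ℕ} {V : Set (Fin m → ℝ)} {F : Set (Set (Fin m → ℝ))}
    (hF : F.Finite) (h : ∀ Q ∈ F, DominatesAway V Q) : DominatesAway V (⋃₀ F) := by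
  induction F, hF using Set.Finite.induction_on with
  | empty => exact fun g hg => ⟨g, hg, fun _ _ => le_rfl, by simp⟩
  | @insert Q F _ _ ih =>
    intro g hg
    obtain ⟨s, hs, hs₁, hs₂⟩ := h Q (Set.mem_insert _ _) g hg
    obtain ⟨t, ht, ht₁, ht₂⟩ := ih (fun R hR => h R (Set.mem_insert_of_mem _ hR)) g hg
    refine ⟨s ⊓ t, inf_mem_ratFunctions hs ht, fun x hx => le_min (hs₁ x hx) (ht₁ x hx), ?_⟩
    rw [Set.sUnion_insert]
    rintro x (hx | hx)
    · exact (min_le_left _ _).trans (hs₂ x hx)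
    · exact (min_le_right _ _).trans (ht₂ x hx)

/-- Dually, a maximum dominates wherever one of its terms does, and stays nonpositive on `W`. -/
theorem DominatesAway.sUnion_left {m : ℕ} {W : Set (Fin m → ℝ)} {F : Set (Set (Fin m → ℝ))}
    (hF : F.Finite) (h : ∀ P ∈ F, DominatesAway P W) : DominatesAway (⋃₀ F) W := by
  induction F, hF using Set.Finite.induction_on with
  | empty => exact fun g hg => ⟨0, zero_mem _, by simp, fun _ _ => le_rfl⟩
  | @insert P F _ _ ih =>
    intro g hg
    obtain ⟨s, hs, hs₁, hs₂⟩ := h P (Set.mem_insert _ _) g hg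
    obtain ⟨t, ht, ht₁, ht₂⟩ := ih (fun R hR => h R (Set.mem_insert_of_mem _ hR)) g hg
    refine ⟨s ⊔ t, sup_mem_ratFunctions hs ht, ?_, fun x hx => max_le (hs₂ x hx) (ht₂ x hx)⟩
    rw [Set.sUnion_insert]
    rintro x (hx | hx)
    · exact (hs₁ x hx).trans (le_max_left _ _)
    · exact (ht₁ x hx).trans (le_max_right _ _)

theorem NoTranslatedRays.mono {m : ℕ} {V V' W W' : Set (Fin m → ℝ)} (h : NoTranslatedRays V W)
    (hV : V' ⊆ V) (hW : W' ⊆ W) : NoTranslatedRays V' W' :=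
  fun e he ⟨a, ha⟩ => h e ⟨he.1, he.2.trans hV⟩ ⟨a, ha.1, ha.2.trans hW⟩

theorem dominatesAway_of_noTranslatedRays {m : ℕ} {V W : Set (Fin m → ℝ)}
    (hV : IsFiniteUnionOfRationalPolyhedralSets V) (hW : IsFiniteUnionOfRationalPolyhedralSets W)
    (hdisj : Disjoint V W) (hray : NoTranslatedRays V W) : DominatesAway V W := by
  obtain ⟨F, hF, hFP, rfl⟩ := hV
  obtain ⟨G, hG, hGP, rfl⟩ := hW
  refine .sUnion_left hF fun P hP => .sUnion_right hG fun Q hQ => ?_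
  have hPV := Set.subset_sUnion_of_mem hP
  have hQW := Set.subset_sUnion_of_mem hQ
  exact dominatesAway_polyhedral (hFP P hP) (hGP Q hQ) (hdisj.mono hPV hQW) (hray.mono hPV hQW)

/-! ### Gluing and the map to the pseudodirect product. -/

theorem DominatesAway.exists_extension {m : ℕ} {V W : Set (Fin m → ℝ)} (h : DominatesAway V W)
    {f₁ f₂ : TropRatFun m} (h₁ : f₁ ≠ 0) (h₂ : f₂ ≠ 0) :
    ∃ f : TropRatFun m, (∀ x ∈ V, ratEval x f = ratEval x f₁) ∧
      ∀ x ∈ W, ratEval x f = ratEval x f₂ := by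
  obtain ⟨k₁, hk₁, e₁⟩ := exists_ratFunction h₁
  obtain ⟨k₂, hk₂, e₂⟩ := exists_ratFunction h₂
  set g := k₁ - k₂ with hg
  have hgm : g ∈ ratFunctions m := sub_mem hk₁ hk₂
  obtain ⟨s, hs, hsV, hsW⟩ := h (g ⊔ -g) (sup_mem_ratFunctions hgm (neg_mem hgm))
  -- The clamp leaves `g` unchanged on `V`, where `|g| ≤ s`, and is `0` on `W`, where `s⁺ = 0`.
  obtain ⟨f, hf⟩ : k₂ + ((g ⊓ (s ⊔ 0)) ⊔ -(s ⊔ 0)) ∈ ratFunctions m :=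
    have hs0 := sup_mem_ratFunctions hs (zero_mem _)
    add_mem hk₂ (sup_mem_ratFunctions (inf_mem_ratFunctions hgm hs0) (neg_mem hs0))
  refine ⟨f, fun x hx => ?_, fun x hx => ?_⟩
  · rw [hf, e₁]
    congr 1
    have hx' : max (g x) (-g x) ≤ s x := hsV x hx
    have hl := (le_max_left _ _).trans hx'
    have hr := (le_max_right _ _).trans hx'
    have hgx : g x = k₁ x - k₂ x := rfl
    change k₂ x + max (min (g x) (max (s x) 0)) (-max (s x) 0) = k₁ x
    rw [max_eq_left (by linarith : (0 : ℝ) ≤ s x), min_eq_left hl, max_eq_left (by linarith), hgx]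
    ring
  · rw [hf, e₂]
    congr 1
    change k₂ x + max (min (g x) (max (s x) 0)) (-max (s x) 0) = k₂ x
    rw [max_eq_right (hsW x hx), neg_zero, max_eq_right (min_le_right _ _), add_zero]

theorem toFunOn_eq_iff {m : ℕ} {V : Set (Fin m → ℝ)} {f g : TropRatFun m} :
    toFunOn V f = toFunOn V g ↔ ∀ x ∈ V, ratEval x f = ratEval x g :=
  RingCon.eq _

theorem toFunOn_ne_zero {m : ℕ} {V : Set (Fin m → ℝ)} [hV : Nonempty V] {f : TropRatFun m}
    (hf : f ≠ 0) : toFunOn V f ≠ 0 := by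
  obtain ⟨x, hx⟩ := hV
  rw [← map_zero (toFunOn V), Ne, toFunOn_eq_iff]
  exact fun h => ratEval_ne_zero x hf ((h x hx).trans (map_zero _))

/-- The homomorphism sending `f` to the pair of its classes modulo `E(V₁)` and `E(V₂)`. -/
noncomputable def toPseudoProd {m : ℕ} (V₁ V₂ : Set (Fin m → ℝ)) [Nonempty V₁] [Nonempty V₂] :
    TropRatFun m →ₐ[TropReal] pseudoProd (FunOn V₁) (FunOn V₂) :=
  ((toFunOn V₁).prod (toFunOn V₂)).codRestrict (pseudoProd (FunOn V₁) (FunOn V₂)) fun f => by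
    by_cases hf : f = 0
    · exact Or.inr (by rw [hf, map_zero]; rfl)
    · exact Or.inl ⟨toFunOn_ne_zero hf, toFunOn_ne_zero hf⟩

theorem coe_toPseudoProd {m : ℕ} (V₁ V₂ : Set (Fin m → ℝ)) [Nonempty V₁] [Nonempty V₂]
    (f : TropRatFun m) :
    (toPseudoProd V₁ V₂ f : FunOn V₁ × FunOn V₂) = (toFunOn V₁ f, toFunOn V₂ f) := rfl

theorem toPseudoProd_eq_iff {m : ℕ} (V₁ V₂ : Set (Fin m → ℝ)) [Nonempty V₁] [Nonempty V₂]
    {f g : TropRatFun m} :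
    toPseudoProd V₁ V₂ f = toPseudoProd V₁ V₂ g ↔ ∀ x ∈ V₁ ∪ V₂, ratEval x f = ratEval x g := by
  rw [← Subtype.coe_inj, coe_toPseudoProd, coe_toPseudoProd, Prod.mk_inj, toFunOn_eq_iff,
    toFunOn_eq_iff]
  simp only [Set.mem_union, or_imp, forall_and]

/-- The pairs with exactly one zero entry, absent from the pseudodirect product, could not be glued:
a nonzero rational function is finite at every point of `ℝ ^ m`. -/
theorem DominatesAway.toPseudoProd_surjective {m : ℕ} {V₁ V₂ : Set (Fin m → ℝ)} [Nonempty V₁]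
    [Nonempty V₂] (h : DominatesAway V₁ V₂) : Function.Surjective (toPseudoProd V₁ V₂) := by
  rintro ⟨⟨a₁, a₂⟩, ha⟩
  rcases ha with ⟨h₁, h₂⟩ | ha
  · obtain ⟨f₁, rfl⟩ := RingCon.mkₐ_surjective (α := TropReal) (vanishingCon V₁) a₁
    obtain ⟨f₂, rfl⟩ := RingCon.mkₐ_surjective (α := TropReal) (vanishingCon V₂) a₂
    obtain ⟨f, hf₁, hf₂⟩ := h.exists_extension (f₁ := f₁) (f₂ := f₂)
      (by rintro rfl; exact h₁ (map_zero _)) (by rintro rfl; exact h₂ (map_zero _))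
    exact ⟨f, Subtype.ext (Prod.ext (toFunOn_eq_iff.2 hf₁) (toFunOn_eq_iff.2 hf₂))⟩
  · exact ⟨0, Subtype.ext (by rw [map_zero]; exact ha.symm)⟩

/-- A homomorphism of algebras factors through any surjective one with smaller kernel. -/
theorem exists_algHom_factor {R A B D : Type*} [CommSemiring R] [Semiring A] [Semiring B]
    [Semiring D] [Algebra R A] [Algebra R B] [Algebra R D] (φ : A →ₐ[R] B)
    (hφ : Function.Surjective φ) (ψ : A →ₐ[R] D) (h : ∀ f g, φ f = φ g → ψ f = ψ g) :
    ∃ γ : B →ₐ[R] D, ∀ f, γ (φ f) = ψ f := by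
  have key : ∀ f b, φ f = b → ψ (Function.surjInv hφ b) = ψ f := fun f b e =>
    h _ _ ((Function.surjInv_eq hφ b).trans e.symm)
  have hs := Function.surjInv_eq hφ
  exact ⟨{ toFun := fun b => ψ (Function.surjInv hφ b)
           map_one' := (key 1 1 (map_one φ)).trans (map_one ψ)
           map_zero' := (key 0 0 (map_zero φ)).trans (map_zero ψ)
           map_mul' := fun a b => (key _ _ (by rw [map_mul, hs, hs])).trans (map_mul ψ _ _)
           map_add' := fun a b => (key _ _ (by rw [map_add, hs, hs])).trans (map_add ψ _ _)
           commutes' := fun r => (key _ _ (φ.commutes r)).trans (ψ.commutes r) },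
    fun f => key f _ rfl⟩

end TropicalCongruence

open TropicalCongruence in
theorem lemma3p30 {m : ℕ} {T : Type*} [Semifield T] [Algebra TropReal T]
    (hT : Function.Injective (algebraMap TropReal T))
    (φ : TropRatFun m →ₐ[TropReal] T) (hφ : Function.Surjective φ)
    (hker : RingCon.ker φ.toRingHom = vanishingCon (variety (RingCon.ker φ.toRingHom)))
    (V₁ V₂ : Set (Fin m → ℝ)) [Nonempty V₁] [Nonempty V₂]
    (hV₁ : IsClosed V₁) (hV₂ : IsClosed V₂)
    (hunion : variety (RingCon.ker φ.toRingHom) = V₁ ∪ V₂) (hdisj : Disjoint V₁ V₂) :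
    ∃ γ : T →ₐ[TropReal] pseudoProd (FunOn V₁) (FunOn V₂),
      (∀ f : TropRatFun m, (γ (φ f) : FunOn V₁ × FunOn V₂) = (toFunOn V₁ f, toFunOn V₂ f)) ∧
      Function.Injective γ ∧
      (IsFiniteUnionOfRationalPolyhedralSets V₁ → IsFiniteUnionOfRationalPolyhedralSets V₂ →
        NoTranslatedRays V₁ V₂ → NoTranslatedRays V₂ V₁ → Function.Bijective γ) := by

  have hφ_iff : ∀ f g : TropRatFun m, φ f = φ g ↔ toPseudoProd V₁ V₂ f = toPseudoProd V₁ V₂ g := by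
    intro f g
    -- Both kernels consist of the pairs agreeing on `V₁ ∪ V₂`.
    have e : RingCon.ker φ.toRingHom f g ↔ vanishingCon (V₁ ∪ V₂) f g := by
      rw [← hunion, ← hker]
    rw [toPseudoProd_eq_iff]
    exact (RingCon.ker_apply φ.toRingHom).symm.trans e
  obtain ⟨γ, hγ⟩ := exists_algHom_factor φ hφ (toPseudoProd V₁ V₂) fun f g => (hφ_iff f g).1
  have hinj : Function.Injective γ := by
    intro a b hab
    obtain ⟨f, rfl⟩ := hφ a
    obtain ⟨g, rfl⟩ := hφ b
    rw [hγ, hγ] at hab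
    exact (hφ_iff f g).2 hab
  refine ⟨γ, fun f => by rw [hγ, coe_toPseudoProd], hinj, fun h₁ h₂ hray _ => ⟨hinj, fun y => ?_⟩⟩
  obtain ⟨f, rfl⟩ :=
    (dominatesAway_of_noTranslatedRays h₁ h₂ hdisj hray).toPseudoProd_surjective y
  exact ⟨φ f, hγ f⟩
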